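/- Let $d\ge 1$ be an integer. For $a>0$ and $\alpha>\frac d2$, $\beta>\alpha$, $\gamma>\alpha$, let the Gauss hypergeometric covariance on $\mathbb{R}^d$ be $$G_d(h;a,\alpha,\beta,\gamma)=\frac{\Gamma(\beta-\frac d2)\,\Gamma(\gamma-\frac d2)}{\Gamma(\beta-\alpha+\gamma-\frac d2)\,\Gamma(\alpha-\frac d2)}\left(1-\frac{\|h\|^2}{a^2}\right)_+^{\beta-\alpha+\gamma-\frac d2-1}{}_2F_1\!\left(\beta-\alpha,\gamma-\alpha;\beta-\alpha+\gamma-\tfrac d2;\left(1-\frac{\|h\|^2}{a^2}\right)_+\right),\quad h\in\mathbb{R}^d,$$ where $\|\cdot\|$ is the Euclidean norm, $x_+=\max(x,0)$ and ${}_2F_1$ is the Gauss hypergeometric function. As $a,\alpha,\beta,\gamma$ tend jointly to $+\infty$, with $\beta>\alpha$ and $\gamma>\alpha$, in such a way that $a\sqrt{\frac{\alpha}{\beta\gamma}}$ tends to a positive constant $b$, the function $G_d(\cdot;a,\alpha,\beta,\gamma)$ converges uniformly on $\mathbb{R}^d$ to the Gaussian covariance with scale factor $b$, $h\mapsto\exp\left(-\frac{\|h\|^2}{b^2}\right)$.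 -/

import Mathlib

/-- The Gauss hypergeometric covariance kernel on `ℝ^d` with range `a` and parameters `α, β, γ`:
`Γ(β - d/2) Γ(γ - d/2) / (Γ(β - α + γ - d/2) Γ(α - d/2)) * (1 - ‖h‖²/a²)₊ ^ (β - α + γ - d/2 - 1)
  * ₂F₁(β - α, γ - α; β - α + γ - d/2; (1 - ‖h‖²/a²)₊)`. -/
noncomputable def gaussHypergeometricCov (d : ℕ) (a α β γ : ℝ)
    (h : EuclideanSpace ℝ (Fin d)) : ℝ :=
  Real.Gamma (β - (d : ℝ) / 2) * Real.Gamma (γ - (d : ℝ) / 2) /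
      (Real.Gamma (β - α + γ - (d : ℝ) / 2) * Real.Gamma (α - (d : ℝ) / 2)) *
    (max (1 - ‖h‖ ^ 2 / a ^ 2) 0) ^ (β - α + γ - (d : ℝ) / 2 - 1) *
    ordinaryHypergeometric (β - α) (γ - α) (β - α + γ - (d : ℝ) / 2)
      (max (1 - ‖h‖ ^ 2 / a ^ 2) 0)

/-- The Gaussian covariance kernel on `ℝ^d` with scale factor `b`. -/
noncomputable def gaussianCov (d : ℕ) (b : ℝ) (h : EuclideanSpace ℝ (Fin d)) : ℝ :=
  Real.exp (-(‖h‖ ^ 2 / b ^ 2))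

open MeasureTheory

/-- The Beta integral as a lower Lebesgue integral. -/
theorem lintegral_rpow_mul_one_sub_rpow {p q : ℝ} (hp : 0 < p) (hq : 0 < q) :
    ∫⁻ x : ℝ in Set.Ioo 0 1, ENNReal.ofReal (x ^ (p - 1) * (1 - x) ^ (q - 1)) =
      ENNReal.ofReal (Real.Gamma p * Real.Gamma q / Real.Gamma (p + q)) := by
  have hpos := ProbabilityTheory.beta_pos hp hq
  have h := ProbabilityTheory.lintegral_betaPDF_eq_one hp hq
  rw [ProbabilityTheory.lintegral_betaPDF] at h
  simp_rw [mul_assoc, ENNReal.ofReal_mul (one_div_nonneg.2 hpos.le)] at h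
  rw [lintegral_const_mul _ (by fun_prop)] at h
  change _ = ENNReal.ofReal (ProbabilityTheory.beta p q)
  rw [one_div, ENNReal.ofReal_inv_of_pos hpos] at h
  rw [← one_mul (lintegral _ _), ← ENNReal.mul_inv_cancel (a := ENNReal.ofReal
    (ProbabilityTheory.beta p q)) (by simpa using hpos) ENNReal.ofReal_ne_top, mul_assoc, h,
    mul_one]

theorem Real.Gamma_add_natCast {x : ℝ} (hx : 0 < x) (n : ℕ) :
    Real.Gamma (x + n) = (ascPochhammer ℝ n).eval x * Real.Gamma x := by
  induction n with
  | zero => simp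
  | succ n ih =>
    rw [ascPochhammer_succ_eval, Nat.cast_succ, ← add_assoc,
      Real.Gamma_add_one (by positivity), ih]
    ring

/-- The binomial series of `(1 - x) ^ (-A)`. -/
theorem hasSum_ascPochhammer_div_factorial_mul_pow (A : ℝ) {x : ℝ} (hx0 : 0 ≤ x) (hx1 : x < 1) :
    HasSum (fun n : ℕ => (ascPochhammer ℝ n).eval A / (n.factorial : ℝ) * x ^ n)
      ((1 - x) ^ (-A)) := by
  have h := (Real.one_div_one_sub_rpow_hasFPowerSeriesOnBall_zero A).hasSum (y := x)
    (by
      rw [Metric.mem_eball, edist_dist, dist_zero_right, Real.norm_of_nonneg hx0]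
      exact ENNReal.ofReal_lt_one.2 hx1)
  rw [zero_add, one_div, ← Real.rpow_neg (by linarith)] at h
  simp only [FormalMultilinearSeries.ofScalars_apply_eq, ← Ring.multichoose_eq, smul_eq_mul] at h
  convert! h using 2 with n
  congr 1
  have := Ring.factorial_nsmul_multichoose_eq_ascPochhammer A n
  rw [Polynomial.ascPochhammer_smeval_eq_eval, nsmul_eq_mul] at this
  rw [← this]
  field_simp

theorem ordinaryHypergeometricCoefficient_nonneg {A B C : ℝ} (hA : 0 < A) (hB : 0 < B)
    (hC : 0 < C) (n : ℕ) : 0 ≤ ordinaryHypergeometricCoefficient A B C n := by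
  have := (ascPochhammer_pos n A hA).le
  have := (ascPochhammer_pos n B hB).le
  have := (ascPochhammer_pos n C hC).le
  unfold ordinaryHypergeometricCoefficient
  positivity

/-- Gauss's summation theorem for positive real parameters. -/
theorem hasSum_ordinaryHypergeometricCoefficient {A B s : ℝ} (hA : 0 < A) (hB : 0 < B)
    (hs : 0 < s) :
    HasSum (ordinaryHypergeometricCoefficient A B (A + B + s))
      (Real.Gamma (A + B + s) * Real.Gamma s / (Real.Gamma (A + s) * Real.Gamma (B + s))) := by
  have hC : 0 < A + B + s := by positivity
  have hnn := ordinaryHypergeometricCoefficient_nonneg hA hB hC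
  have gA := Real.Gamma_pos_of_pos (add_pos hA hs)
  have gB := Real.Gamma_pos_of_pos hB
  have gs := Real.Gamma_pos_of_pos hs
  have gBs := Real.Gamma_pos_of_pos (add_pos hB hs)
  have gC := Real.Gamma_pos_of_pos hC
  set k := Real.Gamma (A + B + s) / (Real.Gamma B * Real.Gamma (A + s)) with hk
  have hkpos : 0 < k := by positivity
  have key : ∑' n, ENNReal.ofReal (ordinaryHypergeometricCoefficient A B (A + B + s) n) =
      ENNReal.ofReal (Real.Gamma (A + B + s) * Real.Gamma s /
        (Real.Gamma (A + s) * Real.Gamma (B + s))) := by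
    calc
      _ = ∑' n : ℕ, ∫⁻ x : ℝ in Set.Ioo 0 1, ENNReal.ofReal
          (k * ((ascPochhammer ℝ n).eval A / (n.factorial : ℝ))) *
            ENNReal.ofReal (x ^ (B + n - 1) * (1 - x) ^ (A + s - 1)) := by
        refine tsum_congr fun n => ?_
        have hAn := ascPochhammer_pos n A hA
        rw [lintegral_const_mul _ (by fun_prop),
          lintegral_rpow_mul_one_sub_rpow (by positivity) (by positivity),
          ← ENNReal.ofReal_mul (by positivity), Real.Gamma_add_natCast hB,
          show B + n + (A + s) = A + B + s + n by ring, Real.Gamma_add_natCast hC]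
        have hCn := ascPochhammer_pos n _ hC
        congr 1
        unfold ordinaryHypergeometricCoefficient
        rw [hk]
        field_simp
      _ = ∫⁻ x : ℝ in Set.Ioo 0 1, ∑' n : ℕ, ENNReal.ofReal
          (k * ((ascPochhammer ℝ n).eval A / (n.factorial : ℝ))) *
            ENNReal.ofReal (x ^ (B + n - 1) * (1 - x) ^ (A + s - 1)) :=
        (lintegral_tsum fun n => by fun_prop).symm
      _ = ∫⁻ x : ℝ in Set.Ioo 0 1, ENNReal.ofReal k *
            ENNReal.ofReal (x ^ (B - 1) * (1 - x) ^ (s - 1)) := by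
        refine setLIntegral_congr_fun measurableSet_Ioo fun x hx => ?_
        have hx1 : 0 < 1 - x := by linarith [hx.2]
        have hx0 : 0 < x := hx.1
        have hsum := (hasSum_ascPochhammer_div_factorial_mul_pow A hx.1.le hx.2).mul_left
          (k * (x ^ (B - 1) * (1 - x) ^ (A + s - 1)))
        have hval : k * (x ^ (B - 1) * (1 - x) ^ (A + s - 1)) * (1 - x) ^ (-A) =
            k * (x ^ (B - 1) * (1 - x) ^ (s - 1)) := by
          rw [show s - 1 = (A + s - 1) + -A by ring, Real.rpow_add hx1]
          ring
        rw [hval] at hsum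
        rw [← ENNReal.ofReal_mul hkpos.le, ← hsum.tsum_eq, ENNReal.ofReal_tsum_of_nonneg _
          hsum.summable]
        · refine tsum_congr fun n => ?_
          have hAn := ascPochhammer_pos n A hA
          rw [← ENNReal.ofReal_mul (by positivity), show B + (n : ℝ) - 1 = B - 1 + n by ring,
            Real.rpow_add_natCast hx0.ne']
          congr 1
          ring
        · intro n
          have hAn := ascPochhammer_pos n A hA
          positivity
      _ = _ := by
        rw [lintegral_const_mul _ (by fun_prop), lintegral_rpow_mul_one_sub_rpow hB hs,
          ← ENNReal.ofReal_mul hkpos.le]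
        congr 1
        rw [hk]
        field_simp
  have hsm : Summable (ordinaryHypergeometricCoefficient A B (A + B + s)) := by
    have := ENNReal.summable_toReal (key.trans_ne ENNReal.ofReal_ne_top)
    simpa only [ENNReal.toReal_ofReal (hnn _)] using this
  rw [← ENNReal.ofReal_tsum_of_nonneg hnn hsm, ENNReal.ofReal_eq_ofReal_iff (tsum_nonneg hnn)
    (by positivity)] at key
  exact key ▸ hsm.hasSum

theorem abs_max_one_sub_rpow_sub_exp_le {r y : ℝ} (hr : 0 ≤ r) (hy : 1 ≤ y) :
    |(max (1 - r) 0) ^ y - Real.exp (-(r * y))| ≤ 2 / y := by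
  have hy0 : 0 < y := by linarith
  rcases le_or_gt 1 r with h | h
  · rw [max_eq_right (by linarith), Real.zero_rpow hy0.ne', zero_sub, abs_neg, Real.abs_exp,
      Real.exp_neg, ← one_div, div_le_div_iff₀ (Real.exp_pos _) hy0]
    nlinarith [Real.add_one_le_exp (r * y)]
  · rw [max_eq_left (by linarith)]
    have h1 : (1 - r) ^ y ≤ Real.exp (-(r * y)) := by
      rw [show -(r * y) = -r * y by ring, Real.exp_mul]
      exact Real.rpow_le_rpow (by linarith) (Real.one_sub_le_exp_neg r) hy0.le
    have h2 : Real.exp (-(r * y)) * (1 - y * r ^ 2) ≤ (1 - r) ^ y := by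
      have hb : 1 - y * r ^ 2 ≤ (1 - r ^ 2) ^ y := by
        have := one_add_mul_self_le_rpow_one_add (s := -r ^ 2) (by nlinarith) hy
        calc _ = 1 + y * -r ^ 2 := by ring
          _ ≤ _ := this
          _ = _ := by ring_nf
      calc Real.exp (-(r * y)) * (1 - y * r ^ 2) ≤ Real.exp (-(r * y)) * (1 - r ^ 2) ^ y := by
            gcongr
        _ = (Real.exp (-r) * (1 - r ^ 2)) ^ y := by
            rw [Real.mul_rpow (Real.exp_pos _).le (by nlinarith), ← Real.exp_mul]
            ring_nf
        _ ≤ (1 - r) ^ y := by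
            have he : Real.exp (-r) * (1 + r) ≤ 1 := by
              rw [Real.exp_neg, inv_mul_le_iff₀ (Real.exp_pos _)]
              linarith [Real.add_one_le_exp r]
            refine Real.rpow_le_rpow (mul_nonneg (Real.exp_pos _).le (by nlinarith)) ?_ hy0.le
            nlinarith [mul_le_mul_of_nonneg_right he (by linarith : 0 ≤ 1 - r)]
    rw [abs_sub_comm, abs_of_nonneg (by linarith)]
    have hq : Real.exp (-(r * y)) * (r * y) ^ 2 ≤ 2 := by
      rw [Real.exp_neg, inv_mul_le_iff₀ (Real.exp_pos _)]
      linarith [Real.quadratic_le_exp_of_nonneg (x := r * y) (by positivity),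
        mul_nonneg hr hy0.le]
    rw [le_div_iff₀ hy0]
    nlinarith

theorem abs_exp_neg_mul_sub_exp_neg_le {u v : ℝ} (hu : 0 ≤ u) (hv : 0 ≤ v) :
    |Real.exp (-(u * v)) - Real.exp (-u)| ≤ 2 * |v - 1| := by
  have main : ∀ w : ℝ, 0 ≤ w → Real.exp (-w) * w ≤ 1 := fun w hw => by
    rw [Real.exp_neg, inv_mul_le_iff₀ (Real.exp_pos _)]
    linarith [Real.add_one_le_exp w]
  rcases le_total 1 v with h | h
  · have h1 : Real.exp (-(u * v)) ≤ Real.exp (-u) := Real.exp_le_exp.2 (by nlinarith)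
    have h2 : Real.exp (-u) * (1 - u * (v - 1)) ≤ Real.exp (-(u * v)) := by
      rw [show -(u * v) = -u + -(u * (v - 1)) by ring, Real.exp_add]
      gcongr
      exact Real.one_sub_le_exp_neg _
    rw [abs_sub_comm, abs_of_nonneg (by linarith), abs_of_nonneg (by linarith)]
    nlinarith [mul_le_mul_of_nonneg_right (main u hu) (by linarith : 0 ≤ v - 1)]
  · have h1 : Real.exp (-u) ≤ Real.exp (-(u * v)) := Real.exp_le_exp.2 (by nlinarith)
    rw [abs_of_nonneg (by linarith), abs_of_nonpos (by linarith)]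
    rcases le_total v (1 / 2) with hv2 | hv2
    · have : Real.exp (-(u * v)) ≤ 1 := Real.exp_le_one_iff.2 (by nlinarith [mul_nonneg hu hv])
      linarith [Real.exp_pos (-u)]
    · have h2 : Real.exp (-(u * v)) * (1 - u * (1 - v)) ≤ Real.exp (-u) := by
        rw [show -u = -(u * v) + -(u * (1 - v)) by ring, Real.exp_add]
        gcongr
        exact Real.one_sub_le_exp_neg _
      have h3 := main (u * v) (by positivity)
      have h4 : Real.exp (-(u * v)) * u ≤ 2 := by
        nlinarith [mul_nonneg (Real.exp_pos (-(u * v))).le hu]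
      nlinarith [mul_le_mul_of_nonneg_right h4 (by linarith : 0 ≤ 1 - v)]

/-- The value `₂F₁(A, B; A + B + s; 1)`. -/
noncomputable def hypergeometricAtOne (A B s : ℝ) : ℝ :=
  Real.Gamma (A + B + s) * Real.Gamma s / (Real.Gamma (A + s) * Real.Gamma (B + s))

theorem hypergeometricAtOne_pos {A B s : ℝ} (hA : 0 < A) (hB : 0 < B) (hs : 0 < s) : 0 < hypergeometricAtOne A B s := by
  have := Real.Gamma_pos_of_pos hs
  have := Real.Gamma_pos_of_pos (add_pos hA hs)
  have := Real.Gamma_pos_of_pos (add_pos hB hs)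
  have := Real.Gamma_pos_of_pos (add_pos (add_pos hA hB) hs)
  unfold hypergeometricAtOne
  positivity

theorem hypergeometricAtOne_add_one {A B s : ℝ} (hA : 0 < A) (hB : 0 < B) (hs : 1 < s) :
    A * B / (A + B + s) * hypergeometricAtOne (A + 1) (B + 1) (s - 1) =
      A * B / (s - 1) * hypergeometricAtOne A B s := by
  have hs1 : 0 < s - 1 := by linarith
  have hC : 0 < A + B + s := by linarith
  have hG : Real.Gamma s = (s - 1) * Real.Gamma (s - 1) := by
    simpa using Real.Gamma_add_one hs1.ne'
  unfold hypergeometricAtOne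
  rw [show A + 1 + (B + 1) + (s - 1) = A + B + s + 1 by ring, Real.Gamma_add_one hC.ne',
    show A + 1 + (s - 1) = A + s by ring, show B + 1 + (s - 1) = B + s by ring, hG]
  field_simp

theorem ordinaryHypergeometricCoefficient_succ (A B C : ℝ) (n : ℕ) :
    ((n + 1 : ℕ) : ℝ) * ordinaryHypergeometricCoefficient A B C (n + 1) =
      A * B / C * ordinaryHypergeometricCoefficient (A + 1) (B + 1) (C + 1) n := by
  have h : ∀ x : ℝ, (ascPochhammer ℝ (n + 1)).eval x = x * (ascPochhammer ℝ n).eval (x + 1) := by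
    intro x
    simp [ascPochhammer_succ_left, Polynomial.eval_comp]
  unfold ordinaryHypergeometricCoefficient
  rw [h, h, h, Nat.factorial_succ, Nat.cast_mul, mul_inv, mul_inv]
  have : ((n + 1 : ℕ) : ℝ) ≠ 0 := by positivity
  field_simp

/-- The first moment of the hypergeometric weights. -/
theorem hasSum_natCast_mul_ordinaryHypergeometricCoefficient {A B s : ℝ} (hA : 0 < A)
    (hB : 0 < B) (hs : 1 < s) :
    HasSum (fun n : ℕ => (n : ℝ) * ordinaryHypergeometricCoefficient A B (A + B + s) n)
      (A * B / (s - 1) * hypergeometricAtOne A B s) := by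
  have h := (hasSum_ordinaryHypergeometricCoefficient (A := A + 1) (B := B + 1) (s := s - 1)
    (by positivity) (by positivity) (by linarith)).mul_left (A * B / (A + B + s))
  change HasSum _ (_ * hypergeometricAtOne _ _ _) at h
  rw [hypergeometricAtOne_add_one hA hB hs, show A + 1 + (B + 1) + (s - 1) = A + B + s + 1 by ring] at h
  simp_rw [← ordinaryHypergeometricCoefficient_succ] at h
  simpa using (hasSum_nat_add_iff
    (f := fun n : ℕ => (n : ℝ) * ordinaryHypergeometricCoefficient A B (A + B + s) n) 1).1 h

/-- The second factorial moment of the hypergeometric weights. -/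
theorem hasSum_natCast_mul_sub_one_mul_ordinaryHypergeometricCoefficient {A B s : ℝ}
    (hA : 0 < A) (hB : 0 < B) (hs : 2 < s) :
    HasSum (fun n : ℕ => (n : ℝ) * (n - 1) * ordinaryHypergeometricCoefficient A B (A + B + s) n)
      (A * (A + 1) * B * (B + 1) / ((s - 1) * (s - 2)) * hypergeometricAtOne A B s) := by
  have h := (hasSum_natCast_mul_ordinaryHypergeometricCoefficient (A := A + 1) (B := B + 1)
    (s := s - 1) (by positivity) (by positivity) (by linarith)).mul_left (A * B / (A + B + s))
  rw [mul_left_comm, hypergeometricAtOne_add_one hA hB (by linarith),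
    show A + 1 + (B + 1) + (s - 1) = A + B + s + 1 by ring] at h
  have h' := (hasSum_nat_add_iff
    (g := (A + 1) * (B + 1) / (s - 1 - 1) * (A * B / (s - 1) * hypergeometricAtOne A B s))
    (f := fun n : ℕ =>
    (n : ℝ) * (n - 1) * ordinaryHypergeometricCoefficient A B (A + B + s) n) 1).1 (by
      convert! h using 2 with n
      rw [mul_left_comm (A * B / (A + B + s)), ← ordinaryHypergeometricCoefficient_succ]
      push_cast
      ring)
  convert! h' using 1
  have h1 : s - 1 ≠ 0 := by linarith
  have h2 : s - 2 ≠ 0 := by linarith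
  have h3 : s - 1 - 1 ≠ 0 := by linarith
  simp only [Finset.range_one, Finset.sum_singleton, Nat.cast_zero, zero_mul, add_zero]
  field_simp
  ring

/-- The mean square deviation of `A + B + s - 1 + N` from `(A + s) (B + s) / s`, for `N`
distributed according to the hypergeometric weights, relative to the square of the latter. -/
theorem relative_variance_le {A B s : ℝ} (hA : 0 < A) (hB : 0 < B) (hs : 4 ≤ s) :
    A * (A + 1) * B * (B + 1) / ((s - 1) * (s - 2)) + A * B / (s - 1)
      - 2 * (A * B / s + 1) * (A * B / (s - 1)) + (A * B / s + 1) ^ 2 ≤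
    7 / s * ((A + s) * (B + s) / s) ^ 2 := by
  have hs0 : 0 < s := by linarith
  have h1 : 0 < s - 1 := by linarith
  have h2 : 0 < s - 2 := by linarith
  have hP : 0 < A * B := by positivity
  have hlead : (A * B) ^ 2 * ((s + 2) / (s ^ 2 * ((s - 1) * (s - 2)))) ≤
      (A * B) ^ 2 * (4 / s ^ 3) := by
    gcongr _ * ?_
    rw [div_le_div_iff₀ (by positivity) (by positivity)]
    nlinarith [mul_nonneg (sq_nonneg s) (by nlinarith : 0 ≤ 3 * s ^ 2 - 14 * s + 8)]
  have hmid : A * B * (A + B + 1) / ((s - 1) * (s - 2)) ≤ A * B * (A + B + 1) * (8 / 3 / s ^ 2) := by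
    rw [div_eq_mul_one_div]
    gcongr _ * ?_
    rw [div_le_div_iff₀ (by positivity) (by positivity)]
    nlinarith
  have hlow : A * B / s ≤ A * B / (s - 1) := by gcongr; linarith
  have hlhs : A * (A + 1) * B * (B + 1) / ((s - 1) * (s - 2)) + A * B / (s - 1)
      - 2 * (A * B / s + 1) * (A * B / (s - 1)) + (A * B / s + 1) ^ 2 =
      (A * B) ^ 2 * ((s + 2) / (s ^ 2 * ((s - 1) * (s - 2)))) +
      A * B * (A + B + 1) / ((s - 1) * (s - 2)) + (2 * (A * B / s) - A * B / (s - 1)) + 1 := by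
    field_simp
    ring
  have hrhs : 7 / s * ((A + s) * (B + s) / s) ^ 2 =
      7 * (A * B) ^ 2 / s ^ 3 + 14 * (A * B) * (A + B + s) / s ^ 2 + 7 * (A + B + s) ^ 2 / s := by
    field_simp
    ring
  rw [hlhs, hrhs]
  have e1 : (A * B) ^ 2 * (4 / s ^ 3) ≤ 7 * (A * B) ^ 2 / s ^ 3 := by
    rw [← mul_div_assoc]
    gcongr ?_ / _
    nlinarith [sq_nonneg (A * B)]
  have e2 : A * B * (A + B + 1) * (8 / 3 / s ^ 2) + A * B / s ≤
      14 * (A * B) * (A + B + s) / s ^ 2 := by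
    have : A * B * (A + B + 1) * (8 / 3 / s ^ 2) + A * B / s =
        A * B * (8 / 3 * (A + B + 1) + s) / s ^ 2 := by field_simp
    rw [this]
    gcongr ?_ / _
    nlinarith
  have e3 : 1 ≤ 7 * (A + B + s) ^ 2 / s := by
    rw [le_div_iff₀ hs0]
    nlinarith [mul_pos hA hB, mul_pos hA hs0, mul_pos hB hs0]
  linarith

theorem gaussHypergeometricCov_hasSum (d : ℕ) (a α β γ : ℝ)
    (hβ : α < β) (hγ : α < γ) (hα : 1 ≤ α - (d : ℝ) / 2) (h : EuclideanSpace ℝ (Fin d)) :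
    HasSum (fun n : ℕ => ordinaryHypergeometricCoefficient (β - α) (γ - α)
        ((β - α) + (γ - α) + (α - (d : ℝ) / 2)) n /
          hypergeometricAtOne (β - α) (γ - α) (α - (d : ℝ) / 2) *
        (max (1 - ‖h‖ ^ 2 / a ^ 2) 0) ^ ((β - α) + (γ - α) + (α - (d : ℝ) / 2) - 1 + n))
      (gaussHypergeometricCov d a α β γ h) := by
  have hA : 0 < β - α := by linarith
  have hB : 0 < γ - α := by linarith
  have hs : 0 < α - (d : ℝ) / 2 := by linarith
  set x := max (1 - ‖h‖ ^ 2 / a ^ 2) 0 with hx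
  have hx0 : 0 ≤ x := le_max_right _ _
  have hx1 : x ≤ 1 := max_le (by linarith [show 0 ≤ ‖h‖ ^ 2 / a ^ 2 by positivity]) zero_le_one
  have hC : β - α + γ - (d : ℝ) / 2 = (β - α) + (γ - α) + (α - (d : ℝ) / 2) := by ring
  have hsm := (hasSum_ordinaryHypergeometricCoefficient hA hB hs).summable
  have hnn := ordinaryHypergeometricCoefficient_nonneg hA hB
    (show 0 < (β - α) + (γ - α) + (α - (d : ℝ) / 2) by linarith)
  have hsx : Summable fun n : ℕ => ordinaryHypergeometricCoefficient (β - α) (γ - α)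
      ((β - α) + (γ - α) + (α - (d : ℝ) / 2)) n * x ^ n :=
    Summable.of_nonneg_of_le (fun n => mul_nonneg (hnn n) (by positivity))
      (fun n => mul_le_of_le_one_right (hnn n) (pow_le_one₀ hx0 hx1)) hsm
  have hF := hsx.hasSum.mul_left (1 / hypergeometricAtOne (β - α) (γ - α) (α - (d : ℝ) / 2) *
    x ^ ((β - α) + (γ - α) + (α - (d : ℝ) / 2) - 1))
  unfold gaussHypergeometricCov
  rw [ordinaryHypergeometric_eq_tsum, hC, ← hx]
  convert! hF using 2 with n
  · rw [Real.rpow_add_of_nonneg hx0 (by linarith) (by positivity), Real.rpow_natCast]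
    ring
  · rw [hypergeometricAtOne, one_div_div]
    ring_nf

theorem abs_gaussHypergeometricCov_sub_exp_le (d : ℕ) {a α β γ : ℝ} (ha : 0 < a)
    (hβ : α < β) (hγ : α < γ) (hα : 4 ≤ α - (d : ℝ) / 2) (h : EuclideanSpace ℝ (Fin d)) :
    |gaussHypergeometricCov d a α β γ h - Real.exp (-(‖h‖ ^ 2 / a ^ 2 *
      ((β - (d : ℝ) / 2) * (γ - (d : ℝ) / 2) / (α - (d : ℝ) / 2))))| ≤
    2 / (α - (d : ℝ) / 2 - 1) + 8 / √(α - (d : ℝ) / 2) := by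
  have hG := gaussHypergeometricCov_hasSum d a α β γ hβ hγ (by linarith) h
  rw [show β - (d : ℝ) / 2 = (β - α) + (α - (d : ℝ) / 2) by ring,
    show γ - (d : ℝ) / 2 = (γ - α) + (α - (d : ℝ) / 2) by ring]
  have hA : 0 < β - α := by linarith
  have hB : 0 < γ - α := by linarith
  generalize β - α = A at *
  generalize γ - α = B at *
  generalize α - (d : ℝ) / 2 = s at *
  have hs : 0 < s := by linarith
  set r := ‖h‖ ^ 2 / a ^ 2
  have hr : 0 ≤ r := by positivity
  have hF := hypergeometricAtOne_pos hA hB hs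
  set F := hypergeometricAtOne A B s with hFdef
  set p : ℕ → ℝ := fun n => ordinaryHypergeometricCoefficient A B (A + B + s) n / F with hp
  have hp0 : ∀ n, 0 ≤ p n := fun n =>
    div_nonneg (ordinaryHypergeometricCoefficient_nonneg hA hB (by positivity) n) hF.le
  set M := (A + s) * (B + s) / s with hM
  have hMpos : 0 < M := by positivity
  have m0 : HasSum p 1 := by
    have := (hasSum_ordinaryHypergeometricCoefficient hA hB hs).div_const F
    change HasSum p (F / F) at this
    rwa [div_self hF.ne'] at this
  have m1 : HasSum (fun n : ℕ => (n : ℝ) * p n) (A * B / (s - 1)) := by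
    have := (hasSum_natCast_mul_ordinaryHypergeometricCoefficient hA hB
      (by linarith : 1 < s)).div_const F
    rw [mul_div_cancel_right₀ _ hF.ne'] at this
    convert! this using 2 with n
    rw [hp]
    ring
  have m2 : HasSum (fun n : ℕ => (n : ℝ) * (n - 1) * p n)
      (A * (A + 1) * B * (B + 1) / ((s - 1) * (s - 2))) := by
    have := (hasSum_natCast_mul_sub_one_mul_ordinaryHypergeometricCoefficient hA hB
      (by linarith : 2 < s)).div_const F
    rw [mul_div_cancel_right₀ _ hF.ne'] at this
    convert! this using 2 with n
    rw [hp]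
    ring
  set V := A * (A + 1) * B * (B + 1) / ((s - 1) * (s - 2)) + A * B / (s - 1)
      - 2 * (A * B / s + 1) * (A * B / (s - 1)) + (A * B / s + 1) ^ 2 with hV
  have hVle : V ≤ 7 / s * M ^ 2 := relative_variance_le hA hB hα
  have hvar : HasSum (fun n : ℕ => p n * ((A + B + s - 1 + n) / M - 1) ^ 2) (V / M ^ 2) := by
    have := (((m2.add m1).sub (m1.mul_left (2 * (A * B / s + 1)))).add
      (m0.mul_left ((A * B / s + 1) ^ 2))).div_const (M ^ 2)
    rw [mul_one] at this
    convert! this using 2 with n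
    have : A + B + s - 1 = M - (A * B / s + 1) := by
      rw [hM]
      field_simp
      ring
    rw [this]
    field_simp
    ring
  have hbound := (m0.mul_left (2 / (s - 1) + 1 / √s)).add (hvar.mul_left (√s))
  have hlim := hG.sub (m0.mul_right (Real.exp (-(r * M))))
  rw [one_mul] at hlim
  have hsq : 0 < √s := Real.sqrt_pos.2 hs
  have hterm : ∀ n : ℕ, ‖p n * (max (1 - r) 0) ^ (A + B + s - 1 + n) -
      p n * Real.exp (-(r * M))‖ ≤
      (2 / (s - 1) + 1 / √s) * p n + √s * (p n * ((A + B + s - 1 + n) / M - 1) ^ 2) := by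
    intro n
    have hn : (0 : ℝ) ≤ n := n.cast_nonneg
    have hy : 1 ≤ A + B + s - 1 + n := by linarith
    set y := A + B + s - 1 + (n : ℝ)
    have t1 := abs_max_one_sub_rpow_sub_exp_le hr hy
    have t2 := abs_exp_neg_mul_sub_exp_neg_le (u := r * M) (v := y / M) (by positivity)
      (by positivity)
    rw [show r * M * (y / M) = r * y by field_simp] at t2
    have t3 : 2 / y ≤ 2 / (s - 1) := by
      gcongr
      · linarith
      · linarith
    have t4 : 2 * |y / M - 1| ≤ 1 / √s + √s * (y / M - 1) ^ 2 := by
      rw [← sq_abs (y / M - 1)]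
      set w := |y / M - 1|
      have : 1 / √s + √s * w ^ 2 - 2 * w = (√s * w - 1) ^ 2 / √s := by
        field_simp
        ring
      have : 0 ≤ (√s * w - 1) ^ 2 / √s := by positivity
      linarith
    have t5 := abs_sub_le ((max (1 - r) 0) ^ y) (Real.exp (-(r * y))) (Real.exp (-(r * M)))
    rw [← mul_sub, norm_mul, Real.norm_of_nonneg (hp0 n), Real.norm_eq_abs]
    calc p n * _ ≤ p n * (2 / (s - 1) + (1 / √s + √s * (y / M - 1) ^ 2)) := by
          gcongr
          · exact hp0 n
          · linarith
      _ = _ := by ring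
  have hfin := hlim.norm_le_of_bounded hbound hterm
  rw [Real.norm_eq_abs] at hfin
  refine hfin.trans ?_
  have h7 : V / M ^ 2 ≤ 7 / s := by rwa [div_le_iff₀ (by positivity)]
  have h8 : √s * (V / M ^ 2) ≤ 7 / √s := by
    calc _ ≤ √s * (7 / s) := by gcongr
      _ = 7 / √s := by
        nth_rewrite 2 [← Real.sq_sqrt hs.le]
        field_simp
  have : 1 / √s + 7 / √s = 8 / √s := by ring
  linarith

theorem theorem15 (d : ℕ) {ι : Type*} (l : Filter ι) (a α β γ : ι → ℝ) (b : ℝ) (hb : 0 < b)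
    (ha : Filter.Tendsto a l Filter.atTop)
    (hα : Filter.Tendsto α l Filter.atTop)
    (hβ : Filter.Tendsto β l Filter.atTop)
    (hγ : Filter.Tendsto γ l Filter.atTop)
    (hαβ : ∀ᶠ i in l, α i < β i)
    (hαγ : ∀ᶠ i in l, α i < γ i)
    (hlim : Filter.Tendsto (fun i => a i * Real.sqrt (α i / (β i * γ i))) l (nhds b)) :
    TendstoUniformly (fun i => gaussHypergeometricCov d (a i) (α i) (β i) (γ i))
      (gaussianCov d b) l := by
  have hs : Filter.Tendsto (fun i => α i - (d : ℝ) / 2) l Filter.atTop :=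
    Filter.tendsto_atTop_add_const_right _ _ hα
  have hone : ∀ f : ι → ℝ, Filter.Tendsto f l Filter.atTop →
      Filter.Tendsto (fun i => 1 - (d : ℝ) / 2 / f i) l (nhds 1) := fun f hf => by
    simpa using tendsto_const_nhds.sub (hf.const_div_atTop ((d : ℝ) / 2))
  set v : ι → ℝ := fun i => b ^ 2 / a i ^ 2 *
    ((β i - (d : ℝ) / 2) * (γ i - (d : ℝ) / 2) / (α i - (d : ℝ) / 2)) with hv
  have hv1 : Filter.Tendsto v l (nhds 1) := by
    have h1 : Filter.Tendsto (fun i => b ^ 2 / (a i * √(α i / (β i * γ i))) ^ 2 *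
        ((1 - (d : ℝ) / 2 / β i) * (1 - (d : ℝ) / 2 / γ i) / (1 - (d : ℝ) / 2 / α i))) l
        (nhds (b ^ 2 / b ^ 2 * (1 * 1 / 1))) :=
      (tendsto_const_nhds.div (hlim.pow 2) (by positivity)).mul
        (((hone β hβ).mul (hone γ hγ)).div (hone α hα) one_ne_zero)
    rw [div_self (by positivity)] at h1
    norm_num only at h1
    refine h1.congr' ?_
    filter_upwards [ha.eventually_gt_atTop 0, hα.eventually_gt_atTop 0, hβ.eventually_gt_atTop 0,
      hγ.eventually_gt_atTop 0, hs.eventually_gt_atTop 0] with i ha0 hα0 hβ0 hγ0 hs0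
    rw [mul_pow, Real.sq_sqrt (by positivity), one_sub_div hβ0.ne', one_sub_div hγ0.ne',
      one_sub_div hα0.ne', hv]
    field_simp
  have hE : Filter.Tendsto (fun i => 2 / (α i - (d : ℝ) / 2 - 1) + 8 / √(α i - (d : ℝ) / 2) +
      2 * |v i - 1|) l (nhds 0) := by
    have e1 := (Filter.tendsto_atTop_add_const_right _ (-1) hs).const_div_atTop 2
    have e2 := (Real.tendsto_sqrt_atTop.comp hs).const_div_atTop 8
    have e3 := ((hv1.sub_const 1).abs).const_mul 2
    simpa using! (e1.add e2).add e3
  rw [Metric.tendstoUniformly_iff]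
  intro ε hε
  filter_upwards [hE.eventually_lt_const hε, ha.eventually_gt_atTop 0, hαβ, hαγ,
    hs.eventually_ge_atTop 4] with i hi ha0 hβi hγi hsi h
  have k1 := abs_gaussHypergeometricCov_sub_exp_le d ha0 hβi hγi hsi h
  have hv0 : 0 ≤ v i := by
    have : 0 ≤ β i - (d : ℝ) / 2 := by linarith
    have : 0 ≤ γ i - (d : ℝ) / 2 := by linarith
    have : 0 ≤ α i - (d : ℝ) / 2 := by linarith
    rw [hv]
    positivity
  have k2 := abs_exp_neg_mul_sub_exp_neg_le (u := ‖h‖ ^ 2 / b ^ 2) (by positivity) hv0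
  rw [show ‖h‖ ^ 2 / b ^ 2 * v i = ‖h‖ ^ 2 / a i ^ 2 *
    ((β i - (d : ℝ) / 2) * (γ i - (d : ℝ) / 2) / (α i - (d : ℝ) / 2)) by
      rw [hv]
      field_simp] at k2
  rw [dist_comm, Real.dist_eq, gaussianCov]
  exact (abs_sub_le _ _ _).trans_lt ((add_le_add k1 k2).trans_lt hi)
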